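/- Let $(M_p)_{p\in\mathbb N}$ be a sequence of positive numbers with $M_0=1$ such that (M.1) $M_p^2\le M_{p-1}M_{p+1}$ for $p\ge 1$; (M.2) there are $A,H\ge 1$ with $M_{p+q}\le AH^{p+q}M_pM_q$ for all $p,q\in\mathbb N$; (M.3)$'$ $\sum_{p\ge1}M_{p-1}/M_p<\infty$. The associated function of a positive sequence $(N_p)_{p\in\mathbb N}$ is $t\mapsto\sup_{p\in\mathbb N}\log(t^p/N_p)$, $t>0$; write $M(t)$ for that of $(M_p)$. Let $\mathcal R$ be the set of all non-decreasing sequences $r=(r_j)_{j\in\mathbb N}$ of positive numbers tending to infinity, and for $r\in\mathcal R$ let $M_{r_j}$ denote the associated function of the sequence $M_p\prod_{j=0}^{p}r_j$. Let $\Omega\subseteq\mathbb R^d$ be open. For $K\Subset\Omega$ (a compact subset of $\Omega$), $h>0$, $r\in\mathcal R$ and $\phi\in C^\infty(\Omega)$ (complex-valued) put \[\|\phi\|_{K,h}=\sup_{x\in K,\ \alpha\in\mathbb N^d}\frac{|\phi^{(\alpha)}(x)|}{h^{|\alpha|}M_{|\alpha|}},\qquad \|\phi\|_{K,r_j}=\sup_{x\in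 K,\ \alpha\in\mathbb N^d}\frac{|\phi^{(\alpha)}(x)|}{M_{|\alpha|}\prod_{j=0}^{|\alpha|}r_j},\] with values in $[0,\infty]$. Let $\mathcal E^{\{M_p\}}(\Omega)$ be the set of all $\phi\in C^\infty(\Omega)$ such that for every $K\Subset\Omega$ there is $h>0$ with $\|\phi\|_{K,h}<\infty$. For nets $(f_\varepsilon)_\varepsilon\in\mathcal E^{\{M_p\}}(\Omega)^{(0,1]}$ define, with $O$ understood as $\varepsilon\to0^+$ (so that the quantity estimated is finite for all small $\varepsilon$), \begin{align*} (f_\varepsilon)_\varepsilon\in\mathcal E^{\{M_p\}}_{\mathcal M}(\Omega)&\iff(\forall K\Subset\Omega)(\forall k>0)(\exists h>0)\ \|f_\varepsilon\|_{K,h}=O(e^{M(k/\varepsilon)}),\\ (f_\varepsilon)_\varepsilon\in\mathcal E^{\{M_p\}}_{\mathcal N}(\Omega)&\iff(\forall K\Subset\Omega)(\exists k>0)(\exists h>0)\ \|f_\varepsilon\|_{K,h}=O(e^{-M(k/\varepsilon)}),\\ (f_\varepsilon)_\varepsilon\in\widetilde{\mathcal E}^{\{M_p\}}_{\mathcal M}(\Omega)&\iff(\forall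 K\Subset\Omega)(\forall r\in\mathcal R)(\exists s\in\mathcal R)\ \|f_\varepsilon\|_{K,r_j}=O(e^{M_{s_j}(1/\varepsilon)}),\\ (f_\varepsilon)_\varepsilon\in\widetilde{\mathcal E}^{\{M_p\}}_{\mathcal N}(\Omega)&\iff(\forall K\Subset\Omega)(\forall r\in\mathcal R)(\forall s\in\mathcal R)\ \|f_\varepsilon\|_{K,r_j}=O(e^{-M_{s_j}(1/\varepsilon)}). \end{align*} Then \[\mathcal E^{\{M_p\}}_{\mathcal M}(\Omega)=\widetilde{\mathcal E}^{\{M_p\}}_{\mathcal M}(\Omega)\qquad\text{and}\qquad\mathcal E^{\{M_p\}}_{\mathcal N}(\Omega)=\widetilde{\mathcal E}^{\{M_p\}}_{\mathcal N}(\Omega).\] -/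

import Mathlib

open Set Filter Topology
open scoped ENNReal ContDiff

noncomputable section

namespace Roumieu

/-- Positive weight sequences with `M 0 = 1` satisfying `(M.1)`, `(M.2)` and `(M.3)'`. -/
structure IsWeightSequence (M : ℕ → ℝ) : Prop where
  pos : ∀ p, 0 < M p
  zero : M 0 = 1
  /-- `(M.1)`: logarithmic convexity. -/
  logConvex : ∀ p, M (p + 1) ^ 2 ≤ M p * M (p + 2)
  /-- `(M.2)`: stability under ultradifferential operators. -/
  stable : ∃ A H : ℝ, 1 ≤ A ∧ 1 ≤ H ∧ ∀ p q, M (p + q) ≤ A * H ^ (p + q) * M p * M q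
  /-- `(M.3)'`: non-quasianalyticity. -/
  nonQuasianalytic : Summable fun p => M p / M (p + 1)

/-- The associated function `t ↦ sup_p log (t ^ p / N p)`. It is only ever evaluated at `t > 0`,
and for sequences for which the supremum is finite there. -/
def assocFun (N : ℕ → ℝ) (t : ℝ) : ℝ :=
  ⨆ p : ℕ, Real.log (t ^ p / N p)

/-- The family `R` of non-decreasing sequences of positive numbers tending to infinity. -/
def R : Set (ℕ → ℝ) :=
  {r | (∀ j, 0 < r j) ∧ Monotone r ∧ Tendsto r atTop atTop}

/-- The sequence `p ↦ M p * ∏_{j = 0}^{p} r j`. -/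
def twist (M r : ℕ → ℝ) (p : ℕ) : ℝ :=
  M p * ∏ j ∈ Finset.range (p + 1), r j

variable {d : ℕ}

/-- The partial derivative in the `i`-th coordinate direction. -/
def partialDeriv (i : Fin d) (φ : EuclideanSpace ℝ (Fin d) → ℂ) :
    EuclideanSpace ℝ (Fin d) → ℂ :=
  fun x => lineDeriv ℝ φ x (EuclideanSpace.single i 1)

/-- The derivative `φ^(α) = ∂₁^α₁ ⋯ ∂_d^α_d φ` for a multi-index `α`. -/
def multiDeriv (α : Fin d → ℕ) (φ : EuclideanSpace ℝ (Fin d) → ℂ) :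
    EuclideanSpace ℝ (Fin d) → ℂ :=
  (List.finRange d).foldr (fun i ψ => (partialDeriv i)^[α i] ψ) φ

/-- `sup_{x ∈ K, α} |φ^(α)(x)| / N_{|α|}`, with values in `[0, ∞]`. -/
def supNorm (N : ℕ → ℝ) (K : Set (EuclideanSpace ℝ (Fin d)))
    (φ : EuclideanSpace ℝ (Fin d) → ℂ) : ℝ≥0∞ :=
  ⨆ x ∈ K, ⨆ α : Fin d → ℕ, ENNReal.ofReal (‖multiDeriv α φ x‖ / N (∑ i, α i))

/-- The norm of `E^{{M_p},h}(K)`. -/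
def normH (M : ℕ → ℝ) (h : ℝ) (K : Set (EuclideanSpace ℝ (Fin d)))
    (φ : EuclideanSpace ℝ (Fin d) → ℂ) : ℝ≥0∞ :=
  supNorm (fun p => h ^ p * M p) K φ

/-- The projective seminorm `‖φ‖_{K, r_j}`. -/
def normR (M r : ℕ → ℝ) (K : Set (EuclideanSpace ℝ (Fin d)))
    (φ : EuclideanSpace ℝ (Fin d) → ℂ) : ℝ≥0∞ :=
  supNorm (twist M r) K φ

/-- The space `E^{M_p}(Ω)` of ultradifferentiable functions of Roumieu type. A function on `Ω` is
represented by a function on the whole space, whose values off the open set `Ω` play no role. -/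
def ultradiff (M : ℕ → ℝ) (Ω : Set (EuclideanSpace ℝ (Fin d))) :
    Set (EuclideanSpace ℝ (Fin d) → ℂ) :=
  {φ | ContDiffOn ℝ ∞ φ Ω ∧
    ∀ K, IsCompact K → K ⊆ Ω → ∃ h : ℝ, 0 < h ∧ normH M h K φ < ⊤}

/-- `g ε = O(b ε)` as `ε → 0⁺`, for `g` with values in `[0, ∞]`; in particular `g ε` is finite
for all small `ε`. -/
def BigO (g : Ioc (0 : ℝ) 1 → ℝ≥0∞) (b : ℝ → ℝ) : Prop :=
  ∃ C ε₀ : ℝ, 0 < ε₀ ∧ ∀ ε : Ioc (0 : ℝ) 1, (ε : ℝ) < ε₀ → g ε ≤ ENNReal.ofReal (C * b ε)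

/-- Moderate nets of Roumieu type. -/
def moderate (M : ℕ → ℝ) (Ω : Set (EuclideanSpace ℝ (Fin d))) :
    Set (Ioc (0 : ℝ) 1 → EuclideanSpace ℝ (Fin d) → ℂ) :=
  {f | (∀ ε, f ε ∈ ultradiff M Ω) ∧
    ∀ K, IsCompact K → K ⊆ Ω → ∀ k : ℝ, 0 < k → ∃ h : ℝ, 0 < h ∧
      BigO (fun ε => normH M h K (f ε)) (fun ε => Real.exp (assocFun M (k / ε)))}

/-- Negligible nets of Roumieu type. -/
def negligible (M : ℕ → ℝ) (Ω : Set (EuclideanSpace ℝ (Fin d))) :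
    Set (Ioc (0 : ℝ) 1 → EuclideanSpace ℝ (Fin d) → ℂ) :=
  {f | (∀ ε, f ε ∈ ultradiff M Ω) ∧
    ∀ K, IsCompact K → K ⊆ Ω → ∃ k : ℝ, 0 < k ∧ ∃ h : ℝ, 0 < h ∧
      BigO (fun ε => normH M h K (f ε)) (fun ε => Real.exp (-assocFun M (k / ε)))}

/-- Projectively defined moderate nets. -/
def projModerate (M : ℕ → ℝ) (Ω : Set (EuclideanSpace ℝ (Fin d))) :
    Set (Ioc (0 : ℝ) 1 → EuclideanSpace ℝ (Fin d) → ℂ) :=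
  {f | (∀ ε, f ε ∈ ultradiff M Ω) ∧
    ∀ K, IsCompact K → K ⊆ Ω → ∀ r ∈ R, ∃ s ∈ R,
      BigO (fun ε => normR M r K (f ε)) (fun ε => Real.exp (assocFun (twist M s) (1 / ε)))}

/-- Projectively defined negligible nets. -/
def projNegligible (M : ℕ → ℝ) (Ω : Set (EuclideanSpace ℝ (Fin d))) :
    Set (Ioc (0 : ℝ) 1 → EuclideanSpace ℝ (Fin d) → ℂ) :=
  {f | (∀ ε, f ε ∈ ultradiff M Ω) ∧
    ∀ K, IsCompact K → K ⊆ Ω → ∀ r ∈ R, ∀ s ∈ R,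
      BigO (fun ε => normR M r K (f ε)) (fun ε => Real.exp (-assocFun (twist M s) (1 / ε)))}

end Roumieu

end

namespace Roumieu

/-! A sequence `r ∈ R` acts as a parameter growing so slowly that it tests all geometric rates at
once. Products `∏ r j` outgrow every `h ^ p` (`exists_pow_le_prod`). Hence `normR` is controlled by
each `normH`, and the twisted associated function lies below every `assocFun M (k * t)` up to a
constant. Conversely, `exists_mem_R_prod_le` yields products below `(n + 1) ^ p` on prescribed
ranges `p ≤ P n`. This diagonal choice merges countably many estimates into one twist
(`exists_twist_dominating`), and turns the failure of every `normH` estimate into the failure of a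
single `normR` estimate (`exists_violation`). -/

/-- `N` grows faster than every geometric sequence. -/
def RapidGrowth (N : ℕ → ℝ) : Prop :=
  (∀ p, 0 < N p) ∧ ∀ t : ℝ, 0 < t → Tendsto (fun p => t ^ p / N p) atTop (𝓝 0)

/-! ### Rapid growth of weights and of products over `R`. -/

lemma rapidGrowth_of_ratio {N : ℕ → ℝ} (hpos : ∀ p, 0 < N p)
    (h : Tendsto (fun p => N p / N (p + 1)) atTop (𝓝 0)) : RapidGrowth N := by
  refine ⟨hpos, fun t ht => ?_⟩
  have hne : ∀ p, t ^ p / N p ≠ 0 := fun p => (div_pos (pow_pos ht p) (hpos p)).ne'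
  refine (summable_of_ratio_test_tendsto_lt_one (l := 0) zero_lt_one
    (Eventually.of_forall hne) ?_).tendsto_atTop_zero
  have := h.const_mul t
  rw [mul_zero] at this
  refine this.congr fun p => ?_
  have h1 := hpos p
  have h2 := hpos (p + 1)
  rw [Real.norm_of_nonneg (div_pos (pow_pos ht _) h2).le,
    Real.norm_of_nonneg (div_pos (pow_pos ht _) h1).le, pow_succ]
  field_simp

lemma IsWeightSequence.rapidGrowth {M : ℕ → ℝ} (hM : IsWeightSequence M) : RapidGrowth M :=
  rapidGrowth_of_ratio hM.pos hM.nonQuasianalytic.tendsto_atTop_zero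

lemma prod_pos_of_mem_R {r : ℕ → ℝ} (hr : r ∈ R) (p : ℕ) :
    0 < ∏ j ∈ Finset.range (p + 1), r j :=
  Finset.prod_pos fun j _ => hr.1 j

lemma rapidGrowth_prod {r : ℕ → ℝ} (hr : r ∈ R) :
    RapidGrowth fun p => ∏ j ∈ Finset.range (p + 1), r j := by
  refine rapidGrowth_of_ratio (prod_pos_of_mem_R hr) ?_
  have h : Tendsto (fun p => (r (p + 1))⁻¹) atTop (𝓝 0) :=
    (hr.2.2.comp (tendsto_add_atTop_nat 1)).inv_tendsto_atTop
  refine h.congr fun p => ?_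
  rw [Finset.prod_range_succ _ (p + 1)]
  have h1 := prod_pos_of_mem_R hr p
  have h2 := hr.1 (p + 1)
  field_simp

lemma exists_pow_le_prod {r : ℕ → ℝ} (hr : r ∈ R) {h : ℝ} (hh : 0 < h) :
    ∃ C : ℝ, 0 < C ∧ ∀ p, h ^ p ≤ C * ∏ j ∈ Finset.range (p + 1), r j := by
  obtain ⟨C, hC⟩ := ((rapidGrowth_prod hr).2 h hh).bddAbove_range
  refine ⟨max C 1, by positivity, fun p => ?_⟩
  rw [← div_le_iff₀ (prod_pos_of_mem_R hr p)]
  exact (hC ⟨p, rfl⟩).trans (le_max_left _ _)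

lemma twist_pos {M r : ℕ → ℝ} (hM : IsWeightSequence M) (hr : r ∈ R) (p : ℕ) :
    0 < twist M r p :=
  mul_pos (hM.pos p) (prod_pos_of_mem_R hr p)

lemma rapidGrowth_twist {M r : ℕ → ℝ} (hM : IsWeightSequence M) (hr : r ∈ R) :
    RapidGrowth (twist M r) := by
  refine ⟨twist_pos hM hr, fun t ht => ?_⟩
  have := (hM.rapidGrowth.2 t ht).mul ((rapidGrowth_prod hr).2 1 one_pos)
  rw [mul_zero] at this
  refine this.congr fun p => ?_
  rw [one_pow, div_mul_div_comm, mul_one, twist]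

/-! ### Comparison of associated functions. -/

/-- The supremum defining the associated function is attained. -/
lemma RapidGrowth.exists_max {N : ℕ → ℝ} (hN : RapidGrowth N) {t : ℝ} (ht : 0 < t) :
    ∃ p, Real.exp (assocFun N t) = t ^ p / N p ∧ ∀ q, t ^ q / N q ≤ t ^ p / N p := by
  have hpos : ∀ q, 0 < t ^ q / N q := fun q => div_pos (pow_pos ht q) (hN.1 q)
  obtain ⟨m, hm⟩ := eventually_atTop.1 ((hN.2 t ht).eventually_lt_const (hpos 0))
  obtain ⟨p, -, hp⟩ := Finset.exists_max_image (Finset.range (m + 1)) (fun q => t ^ q / N q)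
    ⟨0, by simp⟩
  have hmax : ∀ q, t ^ q / N q ≤ t ^ p / N p := fun q => by
    rcases le_total q m with h | h
    · exact hp q (Finset.mem_range.2 (by omega))
    · exact (hm q h).le.trans (hp 0 (by simp))
  refine ⟨p, ?_, hmax⟩
  have hle : ∀ q, Real.log (t ^ q / N q) ≤ Real.log (t ^ p / N p) := fun q =>
    Real.log_le_log (hpos q) (hmax q)
  have : assocFun N t = Real.log (t ^ p / N p) :=
    le_antisymm (ciSup_le hle) (le_ciSup (f := fun q => Real.log (t ^ q / N q))
      ⟨_, by rintro _ ⟨q, rfl⟩; exact hle q⟩ p)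
  rw [this, Real.exp_log (hpos p)]

lemma RapidGrowth.le_exp {N : ℕ → ℝ} (hN : RapidGrowth N) {t : ℝ} (ht : 0 < t) (p : ℕ) :
    t ^ p / N p ≤ Real.exp (assocFun N t) := by
  obtain ⟨q, hq, hmax⟩ := hN.exists_max ht
  exact hq ▸ hmax p

/-- At a maximising index `p` of the twisted supremum, `∏ s j` exceeds a constant multiple of `k⁻¹ ^
p`, which is exactly the dilation by `k`. -/
lemma exists_exp_twist_le {M s : ℕ → ℝ} (hM : IsWeightSequence M) (hs : s ∈ R) {k : ℝ}
    (hk : 0 < k) : ∃ C : ℝ, 0 < C ∧ ∀ t : ℝ, 0 < t →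
      Real.exp (assocFun (twist M s) t) ≤ C * Real.exp (assocFun M (k * t)) := by
  obtain ⟨C, hC, hle⟩ := exists_pow_le_prod hs (inv_pos.2 hk)
  refine ⟨C, hC, fun t ht => ?_⟩
  obtain ⟨p, hp, -⟩ := (rapidGrowth_twist hM hs).exists_max ht
  rw [hp]
  refine le_trans ?_ (mul_le_mul_of_nonneg_left
    (hM.rapidGrowth.le_exp (mul_pos hk ht) p) hC.le)
  have h1 := hM.pos p
  have h2 := prod_pos_of_mem_R hs p
  have h3 := hle p
  have h4 : 1 ≤ C * (∏ j ∈ Finset.range (p + 1), s j) * k ^ p := by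
    have := mul_le_mul_of_nonneg_right h3 (pow_pos hk p).le
    rwa [← mul_pow, inv_mul_cancel₀ hk.ne', one_pow] at this
  rw [twist, mul_pow, ← mul_div_assoc, div_le_div_iff₀ (mul_pos h1 h2) h1]
  have h5 := mul_le_mul_of_nonneg_left h4 (mul_pos (pow_pos ht p) h1).le
  linarith

/-- Constants are absorbed by a dilation of the argument of the associated function. -/
lemma exists_mul_exp_le {M : ℕ → ℝ} (hM : RapidGrowth M) {C : ℝ} (hC : 0 < C) :
    ∃ T : ℝ, ∀ t, T ≤ t → 0 < t →
      C * Real.exp (assocFun M t) ≤ Real.exp (assocFun M (2 * t)) := by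
  obtain ⟨m, hm⟩ := pow_unbounded_of_one_lt C (one_lt_two : (1 : ℝ) < 2)
  have hev : ∀ᶠ t : ℝ in atTop, ∀ p ∈ Finset.range m, t ^ p / t ^ m ≤ 2 ^ m * M p / (C * M m) := by
    refine (Filter.eventually_all_finset _).2 fun p hp => ?_
    have h1 := hM.1 p
    have h2 := hM.1 m
    exact (tendsto_pow_div_pow_atTop_zero (Finset.mem_range.1 hp)).eventually_le_const
      (by positivity)
  obtain ⟨T, hT⟩ := eventually_atTop.1 hev
  refine ⟨T, fun t hTt ht => ?_⟩
  obtain ⟨p, hp, -⟩ := hM.exists_max ht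
  have h1 := hM.1 p
  have h2 := hM.1 m
  rw [hp]
  -- For `p < m` and `t` large, the `m`-th term at `2 * t` beats `C` times the maximum. For `p ≥ m`
  -- the factor `2 ^ p` already absorbs `C`.
  rcases lt_or_ge p m with h | h
  · refine le_trans ?_ (hM.le_exp (by positivity : 0 < 2 * t) m)
    have := hT t hTt p (Finset.mem_range.2 h)
    rw [div_le_div_iff₀ (by positivity) (by positivity)] at this
    rw [mul_pow, ← mul_div_assoc, div_le_div_iff₀ h1 h2]
    linarith
  · refine le_trans ?_ (hM.le_exp (by positivity : 0 < 2 * t) p)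
    rw [mul_pow, ← mul_div_assoc]
    have : C ≤ 2 ^ p := hm.le.trans (pow_le_pow_right₀ one_le_two h)
    gcongr

/-! ### Diagonal construction of sequences in `R`. -/

/-- A sequence in `R` that grows as slowly as prescribed. -/
lemma exists_mem_R_prod_le (P : ℕ → ℕ) :
    ∃ r ∈ R, ∀ n p, p ≤ P n → ∏ j ∈ Finset.range (p + 1), r j ≤ ((n : ℝ) + 1) ^ p := by
  -- The sequence will be `sInf (S j) + 1`, so `j ≤ P n` forces a value at most `n + 1`. The
  -- alternative `j ≤ n` keeps `S j` nonempty.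
  let S : ℕ → Set ℕ := fun j => {n | j ≤ P n ∨ j ≤ n}
  have hne : ∀ j, (S j).Nonempty := fun j => ⟨j, Or.inr le_rfl⟩
  have hmono : Monotone fun j => sInf (S j) := fun i j hij =>
    Nat.sInf_le ((Nat.sInf_mem (hne j)).imp hij.trans hij.trans)
  refine ⟨fun j => (sInf (S j) : ℕ) + 1, ⟨fun j => by positivity, fun i j hij => ?_, ?_⟩, ?_⟩
  · have := hmono hij
    simp only at this ⊢
    gcongr
  · refine tendsto_atTop_add_const_right _ _ (tendsto_natCast_atTop_atTop.comp ?_)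
    refine tendsto_atTop_atTop_of_monotone hmono fun b => ?_
    -- This index is at least `b` and exceeds `P n` for every `n < b`, so no `n < b` lies in its
    -- `S`.
    refine ⟨b + ∑ n ∈ Finset.range b, (P n + 1), ?_⟩
    by_contra! hlt
    rcases Nat.sInf_mem (hne (b + ∑ n ∈ Finset.range b, (P n + 1))) with h | h
    · have := Finset.single_le_sum (f := fun n => P n + 1) (fun _ _ => Nat.zero_le _)
        (Finset.mem_range.2 hlt)
      simp only at this
      omega
    · omega
  · intro n p hp
    -- The factor at `j = 0` equals `1`, so only `p` of the `p + 1` factors count.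
    have h0 : sInf (S 0) = 0 := Nat.sInf_eq_zero.2 (Or.inl (Or.inr le_rfl))
    rw [Finset.prod_range_succ', h0, Nat.cast_zero, zero_add, mul_one]
    calc _ ≤ ∏ _j ∈ Finset.range p, ((n : ℝ) + 1) := by
          refine Finset.prod_le_prod (fun _ _ => by positivity) fun j hj => ?_
          have : sInf (S (j + 1)) ≤ n :=
            Nat.sInf_le (Or.inl ((Nat.succ_le_of_lt (Finset.mem_range.1 hj)).trans hp))
          gcongr
      _ = _ := by simp

/-- Only the maximising index matters: there, dividing `t` by `c` costs at least as much as twisting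
by `s`. -/
lemma exp_le_exp_twist {M s : ℕ → ℝ} (hM : IsWeightSequence M) (hs : s ∈ R) {c t : ℝ}
    (ht : 0 < t) {p : ℕ} (hp : Real.exp (assocFun M (t / c)) = (t / c) ^ p / M p)
    (hle : ∏ j ∈ Finset.range (p + 1), s j ≤ c ^ p) :
    Real.exp (assocFun M (t / c)) ≤ Real.exp (assocFun (twist M s) t) := by
  rw [hp]
  refine le_trans ?_ ((rapidGrowth_twist hM hs).le_exp ht p)
  rw [div_pow, div_div, twist, mul_comm (M p)]
  have h1 := hM.pos p
  have h2 := prod_pos_of_mem_R hs p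
  gcongr

/-- Here `T n` is the threshold past which an `n`-th estimate holds. One `s` serves all of them,
with `n` growing along the blocks `U n ≤ t < U (n + 1)`. -/
lemma exists_twist_dominating {M : ℕ → ℝ} (hM : IsWeightSequence M) (T : ℕ → ℝ) :
    ∃ s ∈ R, ∃ T₀ : ℝ, 0 < T₀ ∧ ∀ t, T₀ ≤ t → ∃ n : ℕ, T n ≤ t ∧
      Real.exp (assocFun M (t / (n + 1))) ≤ Real.exp (assocFun (twist M s) t) := by
  let U : ℕ → ℝ := fun n => n + 1 + ∑ i ∈ Finset.range (n + 1), |T i|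
  have hTU : ∀ n, T n ≤ U n := fun n => by
    have := Finset.single_le_sum (f := fun i => |T i|) (fun _ _ => abs_nonneg _)
      (Finset.self_mem_range_succ n)
    have h2 := le_abs_self (T n)
    have h3 : (0 : ℝ) ≤ n := n.cast_nonneg
    simp only [U]
    linarith
  have hnU : ∀ n : ℕ, (n : ℝ) < U n := fun n => by
    have : 0 ≤ ∑ i ∈ Finset.range (n + 1), |T i| := Finset.sum_nonneg fun _ _ => abs_nonneg _
    simp only [U]
    linarith
  have hUpos : ∀ n, 0 < U n := fun n => (n.cast_nonneg).trans_lt (hnU n)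
  -- Past `P`, terms with argument up to `U (n + 1)` fall below the zeroth term `1`, so on the
  -- `n`-th block the maximising index is less than `P`.
  have hP : ∀ n, ∃ P, ∀ p, P ≤ p → U (n + 1) ^ p / M p < 1 := fun n =>
    eventually_atTop.1 ((hM.rapidGrowth.2 _ (hUpos (n + 1))).eventually_lt_const one_pos)
  choose P hP using hP
  obtain ⟨s, hs, hsP⟩ := exists_mem_R_prod_le P
  refine ⟨s, hs, U 0, hUpos 0, fun t ht => ?_⟩
  have ht0 : 0 < t := (hUpos 0).trans_le ht
  have hex : ∃ n, t < U n := by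
    obtain ⟨n, hn⟩ := exists_nat_gt t
    exact ⟨n, hn.trans (hnU n)⟩
  classical
  obtain ⟨n, hn⟩ : ∃ n, Nat.find hex = n + 1 :=
    Nat.exists_eq_succ_of_ne_zero fun h => (h ▸ Nat.find_spec hex).not_ge ht
  have h1 : t < U (n + 1) := hn ▸ Nat.find_spec hex
  have h2 : U n ≤ t := not_lt.1 (Nat.find_min hex (by omega))
  refine ⟨n, (hTU n).trans h2, ?_⟩
  have hc : (0 : ℝ) < n + 1 := by positivity
  obtain ⟨p, hp, hmax⟩ := hM.rapidGrowth.exists_max (div_pos ht0 hc)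
  refine exp_le_exp_twist hM hs ht0 hp (hsP n p ?_)
  by_contra! hlt
  have h3 := hmax 0
  rw [pow_zero, hM.zero, div_one] at h3
  refine (hP n p hlt.le).not_ge (h3.trans ?_)
  have h4 : t / (n + 1) ≤ U (n + 1) :=
    (div_le_self ht0.le (by linarith [(n.cast_nonneg : (0 : ℝ) ≤ n)])).trans h1.le
  have := hM.pos p
  gcongr

/-! ### Estimates for nets and the inclusions into the projective spaces. -/

variable {d : ℕ}

lemma bigO_supNorm_iff {N : ℕ → ℝ} (hN : ∀ p, 0 < N p) {K : Set (EuclideanSpace ℝ (Fin d))}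
    {f : Ioc (0 : ℝ) 1 → EuclideanSpace ℝ (Fin d) → ℂ} {b : ℝ → ℝ} (hb : ∀ ε, 0 < b ε) :
    BigO (fun ε => supNorm N K (f ε)) b ↔ ∃ C ε₀ : ℝ, 0 < C ∧ 0 < ε₀ ∧
      ∀ ε : Ioc (0 : ℝ) 1, (ε : ℝ) < ε₀ → ∀ x ∈ K, ∀ α : Fin d → ℕ,
        ‖multiDeriv α (f ε) x‖ ≤ C * b ε * N (∑ i, α i) := by
  constructor
  · rintro ⟨C, ε₀, hε₀, h⟩
    refine ⟨max C 1, ε₀, by positivity, hε₀, fun ε hε x hx α => ?_⟩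
    have hpos : 0 ≤ max C 1 * b ε := (mul_pos (by positivity) (hb ε)).le
    rw [← div_le_iff₀ (hN _), ← ENNReal.ofReal_le_ofReal_iff hpos]
    calc _ ≤ supNorm N K (f ε) :=
          le_iSup₂_of_le x hx (le_iSup (fun α : Fin d → ℕ =>
            ENNReal.ofReal (‖multiDeriv α (f ε) x‖ / N (∑ i, α i))) α)
      _ ≤ ENNReal.ofReal (C * b ε) := h ε hε
      _ ≤ _ := ENNReal.ofReal_le_ofReal
          (mul_le_mul_of_nonneg_right (le_max_left _ _) (hb ε).le)
  · rintro ⟨C, ε₀, -, hε₀, h⟩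
    refine ⟨C, ε₀, hε₀, fun ε hε => iSup₂_le fun x hx => iSup_le fun α => ?_⟩
    exact ENNReal.ofReal_le_ofReal ((div_le_iff₀ (hN _)).2 (h ε hε x hx α))

lemma geom_mul_pos {M : ℕ → ℝ} (hM : IsWeightSequence M) {h : ℝ} (hh : 0 < h) (p : ℕ) :
    0 < h ^ p * M p :=
  mul_pos (pow_pos hh p) (hM.pos p)

/-- The seminorms `normR` are dominated by the norms `normH`. -/
lemma bigO_normR_of_normH {M r : ℕ → ℝ} (hM : IsWeightSequence M) (hr : r ∈ R) {h : ℝ}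
    (hh : 0 < h) {K : Set (EuclideanSpace ℝ (Fin d))}
    {f : Ioc (0 : ℝ) 1 → EuclideanSpace ℝ (Fin d) → ℂ} {b : ℝ → ℝ} (hb : ∀ ε, 0 < b ε)
    (H : BigO (fun ε => normH M h K (f ε)) b) : BigO (fun ε => normR M r K (f ε)) b := by
  obtain ⟨C, ε₀, hC, hε₀, H⟩ := (bigO_supNorm_iff (geom_mul_pos hM hh) hb).1 H
  obtain ⟨c, hc, hle⟩ := exists_pow_le_prod hr hh
  refine (bigO_supNorm_iff (twist_pos hM hr) hb).2
    ⟨C * c, ε₀, by positivity, hε₀, fun ε hε x hx α => (H ε hε x hx α).trans ?_⟩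
  have h1 := mul_le_mul_of_nonneg_left (hle (∑ i, α i))
    (mul_pos (mul_pos hC (hb ε)) (hM.pos (∑ i, α i))).le
  rw [twist]
  linarith

lemma BigO.mono {g : Ioc (0 : ℝ) 1 → ℝ≥0∞} {b b' : ℝ → ℝ} (H : BigO g b) {c : ℝ}
    (hb : ∀ ε, 0 < ε → 0 < b ε ∧ b ε ≤ c * b' ε) : BigO g b' := by
  obtain ⟨C, ε₀, hε₀, H⟩ := H
  refine ⟨max C 0 * c, ε₀, hε₀, fun ε hε => (H ε hε).trans (ENNReal.ofReal_le_ofReal ?_)⟩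
  obtain ⟨h1, h2⟩ := hb ε ε.2.1
  rw [mul_assoc]
  exact (mul_le_mul_of_nonneg_right (le_max_left C 0) h1.le).trans
    (mul_le_mul_of_nonneg_left h2 (le_max_right _ _))

lemma moderate_subset_projModerate {M : ℕ → ℝ} (hM : IsWeightSequence M)
    (Ω : Set (EuclideanSpace ℝ (Fin d))) : moderate M Ω ⊆ projModerate M Ω := by
  rintro f ⟨hf, H⟩
  refine ⟨hf, fun K hK hKΩ r hr => ?_⟩
  have key : ∀ n : ℕ, ∃ T : ℝ, ∀ ε : Ioc (0 : ℝ) 1, T ≤ 1 / (ε : ℝ) → ∀ x ∈ K,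
      ∀ α : Fin d → ℕ, ‖multiDeriv α (f ε) x‖ ≤
        Real.exp (assocFun M (1 / ε / (n + 1))) * twist M r (∑ i, α i) := fun n => by
    -- The spare factor `2` pays for absorbing the constant `C`, which depends on `n` and could not
    -- survive letting `n` vary with `ε`.
    have hk : (0 : ℝ) < 1 / (2 * (n + 1)) := by positivity
    obtain ⟨h, hh, hO⟩ := H K hK hKΩ _ hk
    obtain ⟨C, ε₀, hC, hε₀, hO⟩ := (bigO_supNorm_iff (twist_pos hM hr)
      (fun _ => Real.exp_pos _)).1 (bigO_normR_of_normH hM hr hh (fun _ => Real.exp_pos _) hO)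
    obtain ⟨T, hT⟩ := exists_mul_exp_le hM.rapidGrowth hC
    refine ⟨max (1 / ε₀ + 1) (2 * (n + 1) * T), fun ε hε x hx α => ?_⟩
    have hε0 : (0 : ℝ) < ε := ε.2.1
    have h1 : (ε : ℝ) < ε₀ :=
      (one_div_lt_one_div hε₀ hε0).1 (by linarith [(le_max_left _ _).trans hε])
    refine (hO ε h1 x hx α).trans (mul_le_mul_of_nonneg_right ?_ (twist_pos hM hr _).le)
    have h2 := hT (1 / (2 * (n + 1)) / ε) ?_ (by positivity)
    · refine h2.trans_eq ?_
      congr 2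
      field_simp
    · have := (le_max_right _ _).trans hε
      rw [div_div, le_div_iff₀ (by positivity)]
      rw [le_div_iff₀ hε0] at this
      linarith
  choose T hT using key
  obtain ⟨s, hs, T₀, hT₀, hdom⟩ := exists_twist_dominating hM T
  refine ⟨s, hs, (bigO_supNorm_iff (twist_pos hM hr) (fun _ => Real.exp_pos _)).2
    ⟨1, 1 / T₀, one_pos, by positivity, fun ε hε x hx α => ?_⟩⟩
  have hε0 : (0 : ℝ) < ε := ε.2.1
  have h1 : T₀ ≤ 1 / (ε : ℝ) := by
    rw [lt_div_iff₀ hT₀] at hε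
    rw [le_div_iff₀ hε0]
    linarith
  obtain ⟨n, hn, hle⟩ := hdom _ h1
  rw [one_mul]
  exact (hT n ε hn x hx α).trans (mul_le_mul_of_nonneg_right hle (twist_pos hM hr _).le)

lemma negligible_subset_projNegligible {M : ℕ → ℝ} (hM : IsWeightSequence M)
    (Ω : Set (EuclideanSpace ℝ (Fin d))) : negligible M Ω ⊆ projNegligible M Ω := by
  rintro f ⟨hf, H⟩
  refine ⟨hf, fun K hK hKΩ r hr s hs => ?_⟩
  obtain ⟨k, hk, h, hh, hO⟩ := H K hK hKΩ
  obtain ⟨C, hC, hle⟩ := exists_exp_twist_le hM hs hk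
  refine (bigO_normR_of_normH hM hr hh (fun _ => Real.exp_pos _) hO).mono (c := C)
    fun ε hε => ⟨Real.exp_pos _, ?_⟩
  have := hle (1 / ε) (by positivity)
  rw [mul_one_div] at this
  rw [Real.exp_neg, Real.exp_neg, ← div_eq_mul_inv, le_div_iff₀ (Real.exp_pos _),
    inv_mul_le_iff₀ (Real.exp_pos _), mul_comm]
  exact this

/-! ### Reverse inclusions by contradiction. -/

/-- If a net satisfies no estimate in a norm `normH`, with bounds `b n` allowed to vary with `n`,
there are indices tending to `0` and a sequence in `R` along which it is unbounded. -/
lemma exists_violation {M : ℕ → ℝ} (hM : IsWeightSequence M)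
    {K : Set (EuclideanSpace ℝ (Fin d))}
    {f : Ioc (0 : ℝ) 1 → EuclideanSpace ℝ (Fin d) → ℂ} {b : ℕ → ℝ → ℝ} (hb : ∀ n ε, 0 < b n ε)
    (H : ∀ n : ℕ, ¬ BigO (fun ε => normH M (n + 1) K (f ε)) (b n)) :
    ∃ r ∈ R, ∃ e : ℕ → Ioc (0 : ℝ) 1, (∀ n : ℕ, (e n : ℝ) < 1 / (n + 1)) ∧
      ∀ n : ℕ, ∃ x ∈ K, ∃ α : Fin d → ℕ,
        (n + 1) * b n (e n) * twist M r (∑ i, α i) < ‖multiDeriv α (f (e n)) x‖ := by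
  have key : ∀ n : ℕ, ∃ ε : Ioc (0 : ℝ) 1, (ε : ℝ) < 1 / (n + 1) ∧ ∃ x ∈ K, ∃ α : Fin d → ℕ,
      (n + 1) * b n ε * ((n + 1) ^ (∑ i, α i) * M (∑ i, α i)) < ‖multiDeriv α (f ε) x‖ := by
    intro n
    have hn : (0 : ℝ) < n + 1 := by positivity
    by_contra! hcon
    exact H n ((bigO_supNorm_iff (geom_mul_pos hM hn) (hb n)).2
      ⟨n + 1, 1 / (n + 1), hn, by positivity, hcon⟩)
  choose e he x hx α hα using key
  -- With `P n` the order of the `n`-th violating derivative, `∏ r j ≤ (n + 1) ^ |α n|` and the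
  -- violation passes to `twist M r`.
  obtain ⟨r, hr, hrP⟩ := exists_mem_R_prod_le fun n => ∑ i, α n i
  refine ⟨r, hr, e, he, fun n => ⟨x n, hx n, α n, lt_of_le_of_lt ?_ (hα n)⟩⟩
  have h1 := hb n (e n)
  have h2 := hM.pos (∑ i, α n i)
  have h3 := hrP n _ le_rfl
  rw [twist, mul_comm (M _)]
  gcongr

lemma exists_nat_large {C ε₀ : ℝ} (hε₀ : 0 < ε₀) :
    ∃ n : ℕ, C ≤ n + 1 ∧ 1 / ((n : ℝ) + 1) ≤ ε₀ := by
  obtain ⟨n, hn⟩ := exists_nat_gt (max C (1 / ε₀))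
  have h1 := (le_max_left _ _).trans_lt hn
  have h2 := (le_max_right _ _).trans_lt hn
  exact ⟨n, by linarith, (one_div_le (by positivity) hε₀).2 (by linarith)⟩

lemma projModerate_subset_moderate {M : ℕ → ℝ} (hM : IsWeightSequence M)
    (Ω : Set (EuclideanSpace ℝ (Fin d))) : projModerate M Ω ⊆ moderate M Ω := by
  rintro f ⟨hf, H⟩
  refine ⟨hf, fun K hK hKΩ k hk => ?_⟩
  by_contra! hcon
  obtain ⟨r, hr, e, he, hbad⟩ := exists_violation hM
    (b := fun _ ε => Real.exp (assocFun M (k / ε))) (fun _ _ => Real.exp_pos _)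
    (fun n => hcon (n + 1) (by positivity))
  obtain ⟨s, hs, hO⟩ := H K hK hKΩ r hr
  obtain ⟨c, hc, hle⟩ := exists_exp_twist_le hM hs hk
  have hO' : BigO (fun ε => normR M r K (f ε)) (fun ε => Real.exp (assocFun M (k / ε))) :=
    hO.mono (c := c) fun ε hε => ⟨Real.exp_pos _, by
      simpa [mul_one_div, div_eq_mul_inv] using hle (1 / ε) (by positivity)⟩
  obtain ⟨C, ε₀, hC, hε₀, hO'⟩ :=
    (bigO_supNorm_iff (twist_pos hM hr) (fun _ => Real.exp_pos _)).1 hO'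
  obtain ⟨n, hnC, hnε⟩ := exists_nat_large (C := C) hε₀
  obtain ⟨x, hx, α, hlt⟩ := hbad n
  refine hlt.not_ge ((hO' _ ((he n).trans_le hnε) x hx α).trans ?_)
  have := (twist_pos hM hr (∑ i, α i)).le
  gcongr

lemma projNegligible_subset_negligible {M : ℕ → ℝ} (hM : IsWeightSequence M)
    (Ω : Set (EuclideanSpace ℝ (Fin d))) : projNegligible M Ω ⊆ negligible M Ω := by
  rintro f ⟨hf, H⟩
  refine ⟨hf, fun K hK hKΩ => ?_⟩
  by_contra! hcon
  obtain ⟨r, hr, e, he, hbad⟩ := exists_violation hM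
    (b := fun n ε => Real.exp (-assocFun M (1 / ((n : ℝ) + 1) / ε)))
    (fun _ _ => Real.exp_pos _)
    (fun n => hcon (1 / (n + 1)) (by positivity) (n + 1) (by positivity))
  have hmax : ∀ n : ℕ, ∃ q, Real.exp (assocFun M (1 / (e n : ℝ) / (n + 1))) =
      (1 / (e n : ℝ) / (n + 1)) ^ q / M q := fun n => by
    have := (e n).2.1
    obtain ⟨q, hq, -⟩ := hM.rapidGrowth.exists_max
      (show 0 < 1 / (e n : ℝ) / (n + 1) by positivity)
    exact ⟨q, hq⟩
  choose q hq using hmax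
  -- The choice of `s` is fitted to the maximising indices at the violating `e n`, making the
  -- twisted function at `1 / e n` dominate `assocFun M (1 / e n / (n + 1))`.
  obtain ⟨s, hs, hsq⟩ := exists_mem_R_prod_le q
  obtain ⟨C, ε₀, hC, hε₀, hO⟩ :=
    (bigO_supNorm_iff (twist_pos hM hr) (fun _ => Real.exp_pos _)).1 (H K hK hKΩ r hr s hs)
  obtain ⟨n, hnC, hnε⟩ := exists_nat_large (C := C) hε₀
  obtain ⟨x, hx, α, hlt⟩ := hbad n
  have hen : (0 : ℝ) < e n := (e n).2.1
  refine hlt.not_ge ((hO _ ((he n).trans_le hnε) x hx α).trans ?_)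
  have h1 := (twist_pos hM hr (∑ i, α i)).le
  have h2 := exp_le_exp_twist hM hs (one_div_pos.2 hen) (hq n)
    (hsq n _ le_rfl)
  rw [Real.exp_le_exp, div_right_comm] at h2
  gcongr

end Roumieu

theorem mainTheorem7 {d : ℕ} (M : ℕ → ℝ) (hM : Roumieu.IsWeightSequence M)
    (Ω : Set (EuclideanSpace ℝ (Fin d))) (hΩ : IsOpen Ω) :
    Roumieu.moderate M Ω = Roumieu.projModerate M Ω ∧
      Roumieu.negligible M Ω = Roumieu.projNegligible M Ω :=
  ⟨(Roumieu.moderate_subset_projModerate hM Ω).antisymm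
      (Roumieu.projModerate_subset_moderate hM Ω),
    (Roumieu.negligible_subset_projNegligible hM Ω).antisymm
      (Roumieu.projNegligible_subset_negligible hM Ω)⟩
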